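/- Let $q\ge 2$ be an integer and put $Q=\frac{q}{q-1}$. For integers $d,k\ge 1$ and $0<p<\frac{q-1}{q}$ let \[h(p)=h_{d,k}(p)=\frac{d\ln(1-Qp)-k\ln q+\ln(q-1)}{\ln(1-p)},\] and let \[\kappa=k\ln q-\ln(q-1),\qquad y=\sqrt{\frac{\kappa}{2dQ(Q-1)}}.\] Then for all $d,k\ge 1$ the function $h$ attains its minimum on $\left(0,\frac{q-1}{q}\right)$ at exactly one point $p_m=p_m(d,k)$; write $\mu(d,k)=h(p_m)$ for the minimum. Moreover, there exist real numbers $a_i,b_i$ ($i=1,2,\ldots$), depending only on $q$, such that for every integer $r\ge 0$, as $d\to\infty$ and $k/d\to 0$ (with $k\ge 1$), \[p_m=\sum_{i=1}^r a_i y^i+O(y^{r+1})\] and \[\mu(d,k)=dQ+2dQ(Q-1)\sum_{i=1}^r b_i y^i+O(d\,y^{r+1}),\] where the constants implied by $O$ depend only on $q$ and $r$. The first of these numbers are \[a_1=2,\quad a_2=-\frac{8Q+2}{3},\quad a_3=\frac{26Q^2+22Q-1}{9},\quad a_4=-\frac{368Q^3+708Q^2-12Q+8}{135},\] \[b_1=1,\quad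 b_2=\frac{2Q-1}{3},\quad b_3=\frac{2Q^2-2Q-1}{18},\quad b_4=-\frac{4Q^3-6Q^2-6Q+4}{135}.\] -/

import Mathlib

open Filter Topology Asymptotics

noncomputable section

namespace ErrorDetection

/-- `Q = q / (q - 1)`. -/
def bigQ (q : ℕ) : ℝ := (q : ℝ) / ((q : ℝ) - 1)

/-- The admissible symbol error probabilities, the open interval `(0, (q - 1) / q)`. -/
def probs (q : ℕ) : Set ℝ := Set.Ioo 0 (((q : ℝ) - 1) / (q : ℝ))

/-- `h(p) = (d ln(1 - Q p) - k ln q + ln(q - 1)) / ln(1 - p)`. -/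
def h (q d k : ℕ) (p : ℝ) : ℝ :=
  ((d : ℝ) * Real.log (1 - bigQ q * p) - (k : ℝ) * Real.log (q : ℝ) + Real.log ((q : ℝ) - 1)) /
    Real.log (1 - p)

/-- `p` is a point of `(0, (q - 1) / q)` at which `h` attains its minimum over that interval. -/
def IsMinimizer (q d k : ℕ) (p : ℝ) : Prop :=
  p ∈ probs q ∧ IsMinOn (h q d k) (probs q) p

/-- The minimizer `p_m` of `h` (that it exists and is unique is part of the theorem). -/
def pMin (q d k : ℕ) : ℝ := Classical.epsilon (IsMinimizer q d k)

/-- The number `μ(d, k)`, the minimum of `h` on `(0, (q - 1) / q)`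
(that the infimum is attained is part of the theorem). -/
def mu (q d k : ℕ) : ℝ := sInf (h q d k '' probs q)

/-- `κ = k ln q - ln(q - 1)`. -/
def kappa (q k : ℕ) : ℝ := (k : ℝ) * Real.log (q : ℝ) - Real.log ((q : ℝ) - 1)

/-- `y = √(κ / (2 d Q (Q - 1)))`. -/
def yPar (q d k : ℕ) : ℝ :=
  Real.sqrt (kappa q k / (2 * (d : ℝ) * bigQ q * (bigQ q - 1)))

/-- The regime `d → ∞`, `k / d → 0` for pairs `(d, k)` with `k ≥ 1`. An estimate along this
filter holds for all `(d, k)` with `k ≥ 1`, `d` large enough and `k / d` small enough, uniformly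
in both. -/
def regime : Filter (ℕ × ℕ) :=
  comap (fun x : ℕ × ℕ => x.1) atTop ⊓
    comap (fun x : ℕ × ℕ => (x.2 : ℝ) / (x.1 : ℝ)) (𝓝 0) ⊓
    𝓟 {x : ℕ × ℕ | 1 ≤ x.2}

end ErrorDetection

end

/-!
Write `Q = q / (q - 1)` and substitute `s = p / (1 - Q p)`, which maps the interval `(0, 1 / Q)` of
admissible `p` bijectively onto `(0, ∞)`, with inverse `p = s / (1 + Q s)`. Then
`1 - Q p = 1 / (1 + Q s)` and `1 - p = (1 + (Q - 1) s) / (1 + Q s)`, so that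
`h(p) = (d log (1 + Q s) + κ) / (log (1 + Q s) - log (1 + (Q - 1) s))`, which is `ratio` below.

The derivative of this quotient has the sign of `crit Q s - y ^ 2`, where
`crit Q s = ((Q - 1) L(Q s) - Q L((Q - 1) s)) / (2 Q (Q - 1))` with `L(x) = (1 + x) log (1 + x)`
vanishes at `0` and increases strictly to infinity. Hence there is exactly one minimizer, given by
the root `s` of `crit Q s = y ^ 2` (`exists_crit_eq`, `ratio_lt_ratio`), and the minimum is the
quotient of the derivatives of numerator and denominator there: `d Q (1 + (Q - 1) s)`
(`ratio_of_crit_eq`).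

Both `p_m = s / (1 + Q s)` and `μ / d = Q + Q (Q - 1) s` are thus analytic functions of the root
`s`, and it remains to expand `s` in `y`. Near `0`, `crit Q s = s ^ 2 (1 / 4 + s k(s))` with `k`
analytic, so for `s > 0` the equation reads `y = s √(1 / 4 + s k(s))`. The right-hand side is
analytic with derivative `1 / 2` at `0`, and the inverse function theorem gives `s = g(y)` with `g`
analytic at `0` (`exists_branch`). The expansions to all orders are the Taylor expansions of
`g / 2` and `g / (1 + Q g)`. In the regime considered `y → 0`, hence `s → 0`, so that the minimizer
eventually lies on this branch (`eventually_eq_branch`).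

The first four coefficients are identified by uniqueness of asymptotic expansions. With `S` the
claimed polynomial for `s / 2`, the Taylor polynomial of `crit` gives
`crit Q (2 S(y)) = y ^ 2 + O(y ^ 6)`. Taking square roots costs one order, so
`√(crit Q (2 S(y))) = y + O(y ^ 5)`, and applying the Lipschitz function `g` yields
`2 S(y) = g(y) + O(y ^ 5)` (`branch_sub_excessSeries_isBigO`).
-/

noncomputable section

namespace ErrorDetection

/-! ### Asymptotic expansions of analytic functions -/

/-- The factor is found by dividing out one root at `0` at a time, with `dslope`. -/
theorem analyticAt_eq_pow_mul_of_isBigO {n : ℕ} {f : ℝ → ℝ} (hf : AnalyticAt ℝ f 0)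
    (h : f =O[𝓝[≠] 0] fun x => x ^ n) :
    ∃ g : ℝ → ℝ, AnalyticAt ℝ g 0 ∧ ∀ x ≠ 0, f x = x ^ n * g x := by
  induction n generalizing f with
  | zero => exact ⟨f, hf, fun x _ => by simp⟩
  | succ n ih =>
    obtain ⟨p, hp⟩ := hf
    have hf0 : f 0 = 0 := by
      have h1 : Tendsto f (𝓝[≠] 0) (𝓝 0) := by
        refine h.trans_tendsto ?_
        have : Tendsto (fun x : ℝ => x ^ (n + 1)) (𝓝 0) (𝓝 (0 ^ (n + 1))) :=
          (continuous_pow _).tendsto 0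
        rw [zero_pow n.succ_ne_zero] at this
        exact this.mono_left nhdsWithin_le_nhds
      exact tendsto_nhds_unique (hp.analyticAt.continuousAt.tendsto.mono_left nhdsWithin_le_nhds) h1
    have hslope : ∀ x, f x = x * dslope f 0 x := fun x => by
      have := sub_smul_dslope f 0 x
      simpa [hf0] using this.symm
    have hO : dslope f 0 =O[𝓝[≠] 0] fun x => x ^ n := by
      have h2 : (fun x : ℝ => x⁻¹ * f x) =O[𝓝[≠] 0] fun x => x⁻¹ * x ^ (n + 1) :=
        (isBigO_refl _ _).mul h
      refine h2.congr' ?_ ?_ <;> filter_upwards [self_mem_nhdsWithin] with x hx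
      · rw [hslope x, inv_mul_cancel_left₀ hx]
      · rw [pow_succ', inv_mul_cancel_left₀ hx]
    obtain ⟨g, hg, hfg⟩ := ih hp.has_fpower_series_dslope_fslope.analyticAt hO
    refine ⟨g, hg, fun x hx => ?_⟩
    rw [hslope x, hfg x hx, pow_succ', mul_assoc]

/-- The sums start at `i = 1`, the constant term being `f 0 = 0`. -/
theorem exists_asymptotic_expansion {f : ℝ → ℝ} (hf : AnalyticAt ℝ f 0) (h0 : f 0 = 0) :
    ∃ c : ℕ → ℝ, ∀ r : ℕ,
      (fun x => f x - ∑ i ∈ Finset.Icc 1 r, c i * x ^ i) =O[𝓝 0] fun x => x ^ (r + 1) := by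
  obtain ⟨p, hp⟩ := hf
  refine ⟨p.coeff, fun r => ?_⟩
  have h := hp.isBigO_sub_partialSum_pow (r + 1)
  have hc : p.coeff 0 = 0 := by
    have := hp.coeff_zero (fun _ => 1)
    rw [h0] at this
    exact this
  have h' : (fun x : ℝ => ‖x‖ ^ (r + 1)) =O[𝓝 0] fun x : ℝ => x ^ (r + 1) :=
    IsBigO.of_bound 1 (by simp)
  refine (h.trans h').congr_left fun x => ?_
  have hsum : p.partialSum (r + 1) x = ∑ i ∈ Finset.range (r + 1), p.coeff i * x ^ i :=
    Finset.sum_congr rfl fun i _ => by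
      rw [p.apply_eq_pow_smul_coeff, smul_eq_mul, mul_comm]
  rw [hsum, Finset.range_eq_Ico, Finset.sum_eq_sum_Ico_succ_bot (by omega), hc, zero_mul, zero_add,
    zero_add]
  rfl

theorem eq_zero_of_sum_isBigO {n : ℕ} {c : ℕ → ℝ}
    (h : (fun x : ℝ => ∑ i ∈ Finset.range n, c i * x ^ i) =O[𝓝[>] 0] fun x => x ^ n) :
    ∀ i < n, c i = 0 := by
  induction n generalizing c with
  | zero => intro i hi; omega
  | succ n ih =>
    have hc : Continuous fun x : ℝ => ∑ i ∈ Finset.range (n + 1), c i * x ^ i := by fun_prop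
    have h1 : Tendsto (fun x : ℝ => x ^ (n + 1)) (𝓝[>] 0) (𝓝 0) := by
      have : Tendsto (fun x : ℝ => x ^ (n + 1)) (𝓝 0) (𝓝 (0 ^ (n + 1))) :=
        (continuous_pow _).tendsto 0
      rw [zero_pow n.succ_ne_zero] at this
      exact this.mono_left nhdsWithin_le_nhds
    have h2 := tendsto_nhds_unique ((hc.tendsto 0).mono_left nhdsWithin_le_nhds)
      (h.trans_tendsto h1)
    have hc0 : c 0 = 0 := by
      simpa [Finset.sum_range_succ'] using h2
    have hO : (fun x : ℝ => ∑ i ∈ Finset.range n, c (i + 1) * x ^ i) =O[𝓝[>] 0]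
        fun x => x ^ n := by
      have h3 := (isBigO_refl (fun x : ℝ => x⁻¹) (𝓝[>] 0)).mul h
      refine h3.congr' ?_ ?_ <;> filter_upwards [self_mem_nhdsWithin] with x hx
      · have hx' : x ≠ 0 := ne_of_gt hx
        rw [Finset.sum_range_succ', hc0, zero_mul, add_zero, Finset.mul_sum]
        refine Finset.sum_congr rfl fun i _ => ?_
        rw [pow_succ]; field_simp
      · rw [pow_succ', inv_mul_cancel_left₀ (ne_of_gt hx)]
    intro i hi
    rcases i with _ | i
    · exact hc0
    · exact ih hO i (by omega)

/-- Only one-sided estimates are assumed: `y` enters as a square root, and the expansions of the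
minimizer are known for positive `y` only. -/
theorem asymptotic_expansion_unique {f : ℝ → ℝ} {c c' : ℕ → ℝ} {r : ℕ}
    (h : (fun x => f x - ∑ i ∈ Finset.Icc 1 r, c i * x ^ i) =O[𝓝[>] 0] fun x => x ^ (r + 1))
    (h' : (fun x => f x - ∑ i ∈ Finset.Icc 1 r, c' i * x ^ i) =O[𝓝[>] 0] fun x => x ^ (r + 1)) :
    ∀ i ∈ Finset.Icc 1 r, c i = c' i := by
  have h3 : (fun x : ℝ => ∑ i ∈ Finset.range (r + 1),
      (if i = 0 then 0 else c i - c' i) * x ^ i) =O[𝓝[>] 0] fun x => x ^ (r + 1) := by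
    refine (h'.sub h).congr_left fun x => ?_
    rw [sub_sub_sub_cancel_left, ← Finset.sum_sub_distrib, Finset.range_eq_Ico,
      Finset.sum_eq_sum_Ico_succ_bot (by omega)]
    simp only [if_true, zero_mul, zero_add]
    refine Finset.sum_congr rfl fun i hi => ?_
    rw [if_neg (by simp at hi; omega), sub_mul]
  intro i hi
  have h4 := eq_zero_of_sum_isBigO h3 i (by simp at hi; omega)
  rw [if_neg (by simp at hi; omega)] at h4
  linarith

/-! ### The minimum in the variable `s` -/

/-- The function of `s = p / (1 - Q p)` whose value at the minimizer is
`y ^ 2 = κ / (2 d Q (Q - 1))`. The division by `2 Q (Q - 1)` makes it `s ^ 2 / 4 + O(s ^ 3)`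
at `0`. -/
def crit (Q s : ℝ) : ℝ :=
  ((Q - 1) * ((1 + Q * s) * Real.log (1 + Q * s)) -
    Q * ((1 + (Q - 1) * s) * Real.log (1 + (Q - 1) * s))) / (2 * Q * (Q - 1))

theorem crit_zero (Q : ℝ) : crit Q 0 = 0 := by simp [crit]

theorem hasDerivAt_crit {Q s : ℝ} (hQ : 1 < Q) (hs : 0 ≤ s) :
    HasDerivAt (crit Q) ((Real.log (1 + Q * s) - Real.log (1 + (Q - 1) * s)) / 2) s := by
  have hQ' : 0 < Q - 1 := by linarith
  have hA : 0 < 1 + Q * s := by positivity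
  have hB : 0 < 1 + (Q - 1) * s := by positivity
  have h1 : HasDerivAt (fun s => 1 + Q * s) Q s := by
    simpa using ((hasDerivAt_id s).const_mul Q).const_add 1
  have h2 : HasDerivAt (fun s => 1 + (Q - 1) * s) (Q - 1) s := by
    simpa using ((hasDerivAt_id s).const_mul (Q - 1)).const_add 1
  have h3 := (((h1.mul (h1.log hA.ne')).const_mul (Q - 1)).sub
    ((h2.mul (h2.log hB.ne')).const_mul Q)).div_const (2 * Q * (Q - 1))
  refine h3.congr_deriv ?_
  field_simp
  ring

/-- The denominator of `ratio`, which is `-log (1 - p)`, is positive. -/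
theorem log_odds_pos {Q s : ℝ} (hQ : 1 < Q) (hs : 0 < s) :
    0 < Real.log (1 + Q * s) - Real.log (1 + (Q - 1) * s) := by
  have hQ' : 0 < Q - 1 := by linarith
  exact sub_pos.2 (Real.log_lt_log (by positivity) (by linarith))

theorem strictMonoOn_crit {Q : ℝ} (hQ : 1 < Q) : StrictMonoOn (crit Q) (Set.Ici 0) := by
  refine strictMonoOn_of_deriv_pos (convex_Ici 0)
    (fun s hs => (hasDerivAt_crit hQ hs).continuousAt.continuousWithinAt) fun s hs => ?_
  rw [interior_Ici] at hs
  rw [(hasDerivAt_crit hQ (le_of_lt hs)).deriv]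
  exact half_pos (log_odds_pos hQ hs)

/-- The bound that makes `crit` unbounded; it comes from `log x ≥ 1 - 1 / x` at
`x = (1 + Q s) / (1 + (Q - 1) s)`. -/
theorem crit_lower_bound {Q s : ℝ} (hQ : 1 < Q) (hs : 0 ≤ s) :
    (Q - 1) * s - Real.log (1 + Q * s) ≤ 2 * Q * (Q - 1) * crit Q s := by
  have hQ' : 0 < Q - 1 := by linarith
  have hA : 0 < 1 + Q * s := by positivity
  have hB : 0 < 1 + (Q - 1) * s := by positivity
  have h1 : 1 - (1 + (Q - 1) * s) / (1 + Q * s) ≤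
      Real.log (1 + Q * s) - Real.log (1 + (Q - 1) * s) := by
    have := Real.one_sub_inv_le_log_of_pos (div_pos hA hB)
    rwa [inv_div, Real.log_div hA.ne' hB.ne'] at this
  have h2 : 2 * Q * (Q - 1) * crit Q s =
      Q * (1 + (Q - 1) * s) * (Real.log (1 + Q * s) - Real.log (1 + (Q - 1) * s)) -
        Real.log (1 + Q * s) := by
    unfold crit; field_simp; ring
  have h3 : (Q - 1) * s ≤ Q * (1 + (Q - 1) * s) * (1 - (1 + (Q - 1) * s) / (1 + Q * s)) := by
    have : Q * (1 + (Q - 1) * s) * (1 - (1 + (Q - 1) * s) / (1 + Q * s)) - (Q - 1) * s =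
        s / (1 + Q * s) := by field_simp; ring
    have : 0 ≤ s / (1 + Q * s) := by positivity
    linarith
  have h4 := mul_le_mul_of_nonneg_left h1 (show 0 ≤ Q * (1 + (Q - 1) * s) by positivity)
  linarith

theorem tendsto_crit_atTop {Q : ℝ} (hQ : 1 < Q) : Tendsto (crit Q) atTop atTop := by
  have hQ' : 0 < Q - 1 := by linarith
  have hQ0 : 0 < Q := by linarith
  have h1 : Tendsto (fun s : ℝ => 1 + Q * s) atTop atTop :=
    tendsto_atTop_add_const_left _ _ (tendsto_id.const_mul_atTop hQ0)
  have h2 := (Real.isLittleO_log_id_atTop.comp_tendsto h1).bound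
    (show 0 < (Q - 1) / (2 * Q) by positivity)
  have h3 : Tendsto (fun s : ℝ => ((Q - 1) / 2 * s - (Q - 1) / (2 * Q)) / (2 * Q * (Q - 1)))
      atTop atTop :=
    (tendsto_atTop_add_const_right _ _ (tendsto_id.const_mul_atTop (half_pos hQ'))).atTop_div_const
      (by positivity)
  refine tendsto_atTop_mono' _ ?_ h3
  filter_upwards [h2, eventually_ge_atTop 0] with s hs hs0
  have h4 := crit_lower_bound hQ hs0
  rw [div_le_iff₀ (by positivity)]
  have h5 : Real.log (1 + Q * s) ≤ (Q - 1) / (2 * Q) * (1 + Q * s) := by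
    have := (le_abs_self _).trans hs
    simpa [abs_of_pos (show 0 < 1 + Q * s by positivity)] using this
  have h6 : (Q - 1) / (2 * Q) * (1 + Q * s) = (Q - 1) / (2 * Q) + (Q - 1) / 2 * s := by
    field_simp
  linarith

theorem exists_crit_eq {Q c : ℝ} (hQ : 1 < Q) (hc : 0 < c) : ∃ s, 0 < s ∧ crit Q s = c := by
  obtain ⟨t, ht0, ht⟩ :=
    ((eventually_ge_atTop 0).and ((tendsto_crit_atTop hQ).eventually_ge_atTop c)).exists
  have hcont : ContinuousOn (crit Q) (Set.Icc 0 t) := fun s hs =>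
    (hasDerivAt_crit hQ hs.1).continuousAt.continuousWithinAt
  obtain ⟨s, hs, hsc⟩ := intermediate_value_Icc ht0 hcont ⟨by rw [crit_zero]; exact hc.le, ht⟩
  refine ⟨s, lt_of_le_of_ne hs.1 ?_, hsc⟩
  rintro rfl
  rw [crit_zero] at hsc
  exact hc.ne hsc

/-- The function `h` in the variable `s = p / (1 - Q p)`, with `c` in place of `κ`. -/
def ratio (Q d c s : ℝ) : ℝ :=
  (d * Real.log (1 + Q * s) + c) / (Real.log (1 + Q * s) - Real.log (1 + (Q - 1) * s))

/-- The critical equation, solved for the numerator of `ratio`. -/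
theorem ratio_numerator_of_crit_eq {Q d c s₀ : ℝ} (hQ : 1 < Q) (hd : 0 < d)
    (h : crit Q s₀ = c / (2 * d * Q * (Q - 1))) :
    d * Real.log (1 + Q * s₀) + c = d * Q * (1 + (Q - 1) * s₀) *
      (Real.log (1 + Q * s₀) - Real.log (1 + (Q - 1) * s₀)) := by
  have hQ' : 0 < Q - 1 := by linarith
  have hQ0 : 0 < Q := by linarith
  unfold crit at h
  field_simp at h
  linear_combination -h

theorem ratio_of_crit_eq {Q d c s₀ : ℝ} (hQ : 1 < Q) (hd : 0 < d) (hs₀ : 0 < s₀)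
    (h : crit Q s₀ = c / (2 * d * Q * (Q - 1))) :
    ratio Q d c s₀ = d * Q * (1 + (Q - 1) * s₀) := by
  rw [ratio, ratio_numerator_of_crit_eq hQ hd h, mul_div_cancel_right₀]
  exact (log_odds_pos hQ hs₀).ne'

/-- The value `l` of `ratio` at `s₀` is the smallest, because the numerator minus `l` times the
denominator vanishes at `s₀` and its derivative has the sign of `s - s₀`. -/
theorem ratio_lt_ratio {Q d c s₀ s : ℝ} (hQ : 1 < Q) (hd : 0 < d) (hs₀ : 0 < s₀)
    (h : crit Q s₀ = c / (2 * d * Q * (Q - 1))) (hs : 0 < s) (hne : s ≠ s₀) :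
    ratio Q d c s₀ < ratio Q d c s := by
  have hQ' : 0 < Q - 1 := by linarith
  have hQ0 : 0 < Q := by linarith
  set l := d * Q * (1 + (Q - 1) * s₀) with hl
  set F : ℝ → ℝ := fun t => d * Real.log (1 + Q * t) + c -
    l * (Real.log (1 + Q * t) - Real.log (1 + (Q - 1) * t)) with hF
  have hF0 : F s₀ = 0 := by
    rw [hF]; exact sub_eq_zero.2 (ratio_numerator_of_crit_eq hQ hd h)
  have hder : ∀ t, 0 < t → HasDerivAt F
      (d * Q * (Q - 1) * (t - s₀) / ((1 + Q * t) * (1 + (Q - 1) * t))) t := by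
    intro t ht
    have hA : 0 < 1 + Q * t := by positivity
    have hB : 0 < 1 + (Q - 1) * t := by positivity
    have h1 : HasDerivAt (fun s => 1 + Q * s) Q t := by
      simpa using ((hasDerivAt_id t).const_mul Q).const_add 1
    have h2 : HasDerivAt (fun s => 1 + (Q - 1) * s) (Q - 1) t := by
      simpa using ((hasDerivAt_id t).const_mul (Q - 1)).const_add 1
    refine ((((h1.log hA.ne').const_mul d).add_const c).sub
      (((h1.log hA.ne').sub (h2.log hB.ne')).const_mul l)).congr_deriv ?_
    rw [hl]; field_simp; ring
  have hFpos : 0 < F s := by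
    rcases lt_or_gt_of_ne hne with hlt | hgt
    · have : StrictAntiOn F (Set.Ioc 0 s₀) := by
        refine strictAntiOn_of_deriv_neg (convex_Ioc 0 s₀)
          (fun t ht => (hder t ht.1).continuousAt.continuousWithinAt) fun t ht => ?_
        rw [interior_Ioc] at ht
        have ht0 := ht.1
        rw [(hder t ht.1).deriv]
        exact div_neg_of_neg_of_pos (mul_neg_of_pos_of_neg (by positivity) (sub_neg.2 ht.2))
          (by positivity)
      rw [← hF0]
      exact this ⟨hs, hlt.le⟩ ⟨hs₀, le_rfl⟩ hlt
    · have : StrictMonoOn F (Set.Ici s₀) := by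
        refine strictMonoOn_of_deriv_pos (convex_Ici s₀)
          (fun t ht => (hder t (hs₀.trans_le ht)).continuousAt.continuousWithinAt) fun t ht => ?_
        rw [interior_Ici] at ht
        have ht0 : 0 < t := hs₀.trans ht
        have ht1 : 0 < t - s₀ := sub_pos.2 ht
        rw [(hder t ht0).deriv]
        positivity
      rw [← hF0]
      exact this (Set.mem_Ici.2 le_rfl) hgt.le hgt
  rw [ratio_of_crit_eq hQ hd hs₀ h, ratio, lt_div_iff₀ (log_odds_pos hQ hs)]
  exact sub_pos.1 hFpos

/-! ### The analytic branch of the critical equation and its expansion -/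

theorem exists_analytic_local_inverse {f : ℝ → ℝ} {a f' : ℝ} (hf : AnalyticAt ℝ f a)
    (hf' : HasDerivAt f f' a) (h0 : f' ≠ 0) :
    ∃ g : ℝ → ℝ, AnalyticAt ℝ g (f a) ∧ ∀ᶠ x in 𝓝 a, g (f x) = x := by
  have hs : HasStrictDerivAt f f' a := by
    have := hf.hasStrictDerivAt
    rwa [hf'.deriv] at this
  have hs' := hs.hasStrictFDerivAt_equiv h0
  refine ⟨hs'.localInverse f _ a, ?_, hs'.eventually_left_inverse⟩
  exact (hs'.toOpenPartialHomeomorph f).analyticAt_symm' hs'.mem_toOpenPartialHomeomorph_source hf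
    hs'.hasFDerivAt.fderiv

theorem log_one_add_sub_isBigO :
    (fun x : ℝ => Real.log (1 + x) - (x - x ^ 2 / 2 + x ^ 3 / 3 - x ^ 4 / 4 + x ^ 5 / 5))
      =O[𝓝 0] fun x => x ^ 6 := by
  refine IsBigO.of_bound 2 ?_
  filter_upwards [Metric.ball_mem_nhds (0 : ℝ) (show (0 : ℝ) < 1 / 2 by norm_num)] with x hx
  have hx' : |x| < 1 / 2 := by simpa using hx
  have h := Real.abs_log_sub_add_sum_range_le (x := -x) (by rw [abs_neg]; linarith) 5
  rw [abs_neg, sub_neg_eq_add] at h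
  have h1 : (∑ i ∈ Finset.range 5, (-x) ^ (i + 1) / ((i : ℝ) + 1)) + Real.log (1 + x) =
      Real.log (1 + x) - (x - x ^ 2 / 2 + x ^ 3 / 3 - x ^ 4 / 4 + x ^ 5 / 5) := by
    simp only [Finset.sum_range_succ, Finset.sum_range_zero]
    push_cast
    ring
  rw [h1] at h
  rw [Real.norm_eq_abs, norm_pow, Real.norm_eq_abs]
  refine h.trans ?_
  rw [div_le_iff₀ (by linarith)]
  have := pow_nonneg (abs_nonneg x) 6
  norm_num
  nlinarith

/-- The Taylor polynomial of `crit Q` at `0` of degree five. -/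
def critTaylor (Q s : ℝ) : ℝ :=
  s ^ 2 / 4 - (2 * Q - 1) / 12 * s ^ 3 + (Q ^ 3 - (Q - 1) ^ 3) / 24 * s ^ 4 -
    (Q ^ 4 - (Q - 1) ^ 4) / 40 * s ^ 5

/-- Up to constant factors, `crit Q s` is a difference of values of `(1 + x) log (1 + x)` at
`x = Q s` and `x = (Q - 1) s`, so the expansion of the logarithm suffices. -/
theorem crit_sub_critTaylor_isBigO {Q : ℝ} (hQ : 1 < Q) :
    (fun s => crit Q s - critTaylor Q s) =O[𝓝 0] fun s => s ^ 6 := by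
  have hQ' : Q - 1 ≠ 0 := by linarith
  have hQ0 : Q ≠ 0 := by linarith
  set E : ℝ → ℝ := fun x =>
    Real.log (1 + x) - (x - x ^ 2 / 2 + x ^ 3 / 3 - x ^ 4 / 4 + x ^ 5 / 5) with hE
  have hE' : ∀ c : ℝ, (fun s => (1 + c * s) * E (c * s)) =O[𝓝 0] fun s => s ^ 6 := by
    intro c
    have ht : Tendsto (fun s : ℝ => c * s) (𝓝 0) (𝓝 0) := by
      have : Continuous fun s : ℝ => c * s := by fun_prop
      simpa using this.tendsto 0
    have h1 : (fun s => E (c * s)) =O[𝓝 0] fun s => (c * s) ^ 6 :=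
      log_one_add_sub_isBigO.comp_tendsto ht
    have h2 : (fun s => E (c * s)) =O[𝓝 0] fun s => s ^ 6 :=
      h1.trans (by simp_rw [mul_pow]; exact isBigO_const_mul_self _ _ _)
    have h3 : (fun s : ℝ => 1 + c * s) =O[𝓝 0] fun _ => (1 : ℝ) :=
      (show Continuous fun s : ℝ => 1 + c * s by fun_prop).continuousAt.tendsto.isBigO_one ℝ
    simpa using h3.mul h2
  -- The `s ^ 6` term stems from `(1 + x) * (x ^ 5 / 5)`, whose degree exceeds that of `critTaylor`.
  have h := (((hE' Q).const_mul_left (1 / (2 * Q))).sub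
    ((hE' (Q - 1)).const_mul_left (1 / (2 * (Q - 1))))).add
    ((isBigO_refl (fun s : ℝ => s ^ 6) (𝓝 0)).const_mul_left ((Q ^ 5 - (Q - 1) ^ 5) / 10))
  refine h.congr_left fun s => ?_
  simp only [hE, crit, critTaylor]
  field_simp
  ring

/-- The claimed expansion of `(μ - d Q) / (2 d Q (Q - 1)) = s / 2` in powers of `y`, up to order
four. -/
def excessSeries (Q y : ℝ) : ℝ :=
  y + (2 * Q - 1) / 3 * y ^ 2 + (2 * Q ^ 2 - 2 * Q - 1) / 18 * y ^ 3 +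
    -(4 * Q ^ 3 - 6 * Q ^ 2 - 6 * Q + 4) / 135 * y ^ 4

/-- The claimed expansion of `p_m = s / (1 + Q s)` in powers of `y`, up to order four. -/
def minimizerSeries (Q y : ℝ) : ℝ :=
  2 * y + -(8 * Q + 2) / 3 * y ^ 2 + (26 * Q ^ 2 + 22 * Q - 1) / 9 * y ^ 3 +
    -(368 * Q ^ 3 + 708 * Q ^ 2 - 12 * Q + 8) / 135 * y ^ 4

theorem continuous_excessSeries (Q : ℝ) : Continuous (excessSeries Q) := by
  unfold excessSeries; fun_prop

theorem isBigO_pow_mul_of_continuous {R : ℝ → ℝ} (hR : Continuous R) (n : ℕ) :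
    (fun y => y ^ n * R y) =O[𝓝 0] fun y => y ^ n := by
  simpa using (isBigO_refl (fun y : ℝ => y ^ n) (𝓝 0)).mul (hR.continuousAt.tendsto.isBigO_one ℝ)

/-- The identity behind the coefficients of `excessSeries`: it solves the critical equation up to
order five. -/
theorem critTaylor_excessSeries_isBigO (Q : ℝ) :
    (fun y => critTaylor Q (2 * excessSeries Q y) - y ^ 2) =O[𝓝 0] fun y => y ^ 6 := by
  -- The coefficients are abstracted, so that the final identity holds for arbitrary values except
  -- for `h3`, `h4`, `h5`, the vanishing of the coefficients of `y ^ 3`, `y ^ 4`, `y ^ 5`.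
  obtain ⟨b, hb⟩ : ∃ b, b = (2 * Q - 1) / 3 := ⟨_, rfl⟩
  obtain ⟨c, hc⟩ : ∃ c, c = (2 * Q ^ 2 - 2 * Q - 1) / 18 := ⟨_, rfl⟩
  obtain ⟨e, he⟩ : ∃ e, e = -(4 * Q ^ 3 - 6 * Q ^ 2 - 6 * Q + 4) / 135 := ⟨_, rfl⟩
  obtain ⟨A, hA⟩ : ∃ A, A = 2 / 3 * (2 * Q - 1) := ⟨_, rfl⟩
  obtain ⟨B, hB⟩ : ∃ B, B = 2 / 3 * (Q ^ 3 - (Q - 1) ^ 3) := ⟨_, rfl⟩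
  obtain ⟨C, hC⟩ : ∃ C, C = 4 / 5 * (Q ^ 4 - (Q - 1) ^ 4) := ⟨_, rfl⟩
  set t : ℝ → ℝ := fun y => b + c * y + e * y ^ 2 with ht
  -- `R` is the quotient of the difference by `y ^ 6`, with `excessSeries Q y = y * (1 + y * t y)`.
  set R : ℝ → ℝ := fun y =>
    (c ^ 2 + 2 * b * e + 2 * c * e * y + e ^ 2 * y ^ 2) -
    A * (3 * e + 3 * (2 * b * c + 2 * b * e * y + c ^ 2 * y + 2 * c * e * y ^ 2 + e ^ 2 * y ^ 3) +
      t y ^ 3) +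
    B * (4 * (c + e * y) + 6 * t y ^ 2 + 4 * y * t y ^ 3 + y ^ 2 * t y ^ 4) -
    C * (5 * t y + 10 * y * t y ^ 2 + 10 * y ^ 2 * t y ^ 3 + 5 * y ^ 3 * t y ^ 4 +
      y ^ 4 * t y ^ 5) with hR
  have hcont : Continuous R := by fun_prop
  refine (isBigO_pow_mul_of_continuous hcont 6).congr_left fun y => ?_
  have h1 : critTaylor Q (2 * excessSeries Q y) =
      y ^ 2 * ((1 + y * t y) ^ 2 - A * y * (1 + y * t y) ^ 3 + B * y ^ 2 * (1 + y * t y) ^ 4 -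
        C * y ^ 3 * (1 + y * t y) ^ 5) := by
    have h2 : excessSeries Q y = y * (1 + y * t y) := by
      simp only [excessSeries, ht, hb, hc, he]; ring
    rw [h2, critTaylor, hA, hB, hC]
    ring
  have h3 : 2 * b - A = 0 := by rw [hb, hA]; ring
  have h4 : 2 * c + b ^ 2 - A * (3 * b) + B = 0 := by rw [hb, hc, hA, hB]; ring
  have h5 : 2 * e + 2 * b * c - A * (3 * c + 3 * b ^ 2) + B * (4 * b) - C = 0 := by
    rw [hb, hc, he, hA, hB, hC]; ring
  rw [h1]
  simp only [hR, ht]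
  linear_combination (-y ^ 3) * h3 - y ^ 4 * h4 - y ^ 5 * h5

/-- The positive solution `s` of `crit Q s = y ^ 2`, for small `y > 0`, is an analytic function
`g` of `y`. -/
theorem exists_branch {Q : ℝ} (hQ : 1 < Q) :
    ∃ g : ℝ → ℝ, AnalyticAt ℝ g 0 ∧ g 0 = 0 ∧ ∀ᶠ s in 𝓝[>] 0, g √(crit Q s) = s := by
  have hQ' : 0 < Q - 1 := by linarith
  have hlog : ∀ c : ℝ, AnalyticAt ℝ (fun s : ℝ => Real.log (1 + c * s)) 0 := fun c =>
    AnalyticAt.log (by fun_prop) (by simp)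
  have han : AnalyticAt ℝ (crit Q) 0 := by
    unfold crit
    have h1 := hlog Q
    have h2 := hlog (Q - 1)
    exact AnalyticAt.div (by fun_prop) analyticAt_const (by positivity)
  have hO : (fun s => crit Q s - s ^ 2 / 4) =O[𝓝 0] fun s => s ^ 3 := by
    have h1 : (fun s : ℝ => s ^ 6) =O[𝓝 0] fun s => s ^ 3 := 
      (isBigO_pow_mul_of_continuous (continuous_pow 3) 3).congr_left fun s => by ring
    have h2 := isBigO_pow_mul_of_continuous (n := 3) (R := fun s => - ((2 * Q - 1) / 12) +
      (Q ^ 3 - (Q - 1) ^ 3) / 24 * s - (Q ^ 4 - (Q - 1) ^ 4) / 40 * s ^ 2) (by fun_prop)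
    refine (((crit_sub_critTaylor_isBigO hQ).trans h1).add h2).congr_left fun s => ?_
    rw [critTaylor]; ring
  have han' : AnalyticAt ℝ (fun s => crit Q s - s ^ 2 / 4) 0 := han.sub (by fun_prop)
  obtain ⟨k, hk, hkeq⟩ :=
    analyticAt_eq_pow_mul_of_isBigO han' (hO.mono nhdsWithin_le_nhds)
  set f : ℝ → ℝ := fun s => s * √(1 / 4 + s * k s) with hf
  have hrad : AnalyticAt ℝ (fun s => 1 / 4 + s * k s) 0 := by fun_prop
  have hrt : AnalyticAt ℝ (fun s => √(1 / 4 + s * k s)) 0 :=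
    (hrad.contDiffAt (n := ⊤) |>.sqrt (by simp)).analyticAt
  have hfan : AnalyticAt ℝ f 0 := analyticAt_id.mul hrt
  have hfd : HasDerivAt f (1 / 2) 0 := by
    refine ((hasDerivAt_id (0 : ℝ)).mul hrt.differentiableAt.hasDerivAt).congr_deriv ?_
    have : √(1 / 4 : ℝ) = 1 / 2 := by
      rw [show (1 / 4 : ℝ) = (1 / 2) ^ 2 by norm_num, Real.sqrt_sq (by norm_num)]
    simpa using this
  have hf0 : f 0 = 0 := by simp [hf]
  obtain ⟨g, hg, hgf⟩ := exists_analytic_local_inverse hfan hfd (by norm_num)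
  rw [hf0] at hg
  refine ⟨g, hg, ?_, ?_⟩
  · have := hgf.self_of_nhds
    rwa [hf0] at this
  · filter_upwards [nhdsWithin_le_nhds hgf, self_mem_nhdsWithin] with s hs hs0
    have hs0' : 0 < s := hs0
    have : crit Q s = s ^ 2 * (1 / 4 + s * k s) := by
      linear_combination hkeq s hs0'.ne'
    rw [this, Real.sqrt_mul (sq_nonneg s), Real.sqrt_sq hs0'.le]
    exact hs

theorem branch_sub_excessSeries_isBigO {Q : ℝ} (hQ : 1 < Q) {g : ℝ → ℝ} (hg : AnalyticAt ℝ g 0)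
    (hinv : ∀ᶠ s in 𝓝[>] 0, g √(crit Q s) = s) :
    (fun y => g y - 2 * excessSeries Q y) =O[𝓝[>] 0] fun y => y ^ 5 := by
  set S : ℝ → ℝ := fun y => 2 * excessSeries Q y with hS
  have hS0 : Tendsto S (𝓝 0) (𝓝 0) := by
    have : Continuous S := (continuous_excessSeries Q).const_mul 2
    simpa [hS, excessSeries] using this.tendsto 0
  obtain ⟨u, hu, hu0, hSu⟩ : ∃ u : ℝ → ℝ, Continuous u ∧ u 0 = 2 ∧ ∀ y, S y = y * u y :=
    ⟨fun y => 2 * (1 + (2 * Q - 1) / 3 * y + (2 * Q ^ 2 - 2 * Q - 1) / 18 * y ^ 2 +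
      -(4 * Q ^ 3 - 6 * Q ^ 2 - 6 * Q + 4) / 135 * y ^ 3), by fun_prop, by simp, fun y => by
        simp only [hS, excessSeries]; ring⟩
  have hSpos : ∀ᶠ y in 𝓝[>] 0, 0 < S y := by
    have h2 := (hu.tendsto 0).eventually_const_lt (u := 0) (by simp [hu0])
    filter_upwards [nhdsWithin_le_nhds h2, self_mem_nhdsWithin] with y hy hy0
    rw [hSu]
    exact mul_pos hy0 hy
  have hSt : Tendsto S (𝓝[>] 0) (𝓝[>] 0) :=
    tendsto_nhdsWithin_iff.2 ⟨hS0.mono_left nhdsWithin_le_nhds, hSpos⟩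
  have hSO : S =O[𝓝 0] fun y => y := by
    simpa [← hSu] using isBigO_pow_mul_of_continuous hu 1
  have hcrit : (fun y => crit Q (S y) - y ^ 2) =O[𝓝 0] fun y => y ^ 6 := by
    have h1 := ((crit_sub_critTaylor_isBigO hQ).comp_tendsto hS0).trans (hSO.pow 6)
    exact (h1.add (critTaylor_excessSeries_isBigO Q)).congr_left fun y => by
      simp [hS]
  -- The difference of squares is divided by `√(crit Q (S y)) + y ≥ y`.
  have hsqrt : (fun y => √(crit Q (S y)) - y) =O[𝓝[>] 0] fun y => y ^ 5 := by
    obtain ⟨C, hC⟩ := (hcrit.mono (nhdsWithin_le_nhds (s := Set.Ioi 0))).bound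
    refine IsBigO.of_bound C ?_
    filter_upwards [hC, hSpos, self_mem_nhdsWithin] with y hy hSy hy0
    have hy0' : 0 < y := hy0
    have hnn : 0 ≤ crit Q (S y) := by
      rw [← crit_zero Q]
      exact (strictMonoOn_crit hQ).monotoneOn Set.self_mem_Ici hSy.le hSy.le
    have h1 : crit Q (S y) - y ^ 2 = (√(crit Q (S y)) - y) * (√(crit Q (S y)) + y) := by
      nlinarith [Real.sq_sqrt hnn]
    rw [h1, norm_mul, Real.norm_of_nonneg (by positivity : 0 ≤ √(crit Q (S y)) + y),
      Real.norm_of_nonneg (by positivity : 0 ≤ y ^ 6)] at hy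
    rw [Real.norm_of_nonneg (by positivity : 0 ≤ y ^ 5)]
    refine le_of_mul_le_mul_right ?_ hy0'
    calc ‖√(crit Q (S y)) - y‖ * y ≤ ‖√(crit Q (S y)) - y‖ * (√(crit Q (S y)) + y) := by
          gcongr; linarith [Real.sqrt_nonneg (crit Q (S y))]
      _ ≤ C * y ^ 6 := hy
      _ = C * y ^ 5 * y := by ring
  have hst : Tendsto (fun y => √(crit Q (S y))) (𝓝[>] 0) (𝓝 0) := by
    have h1 : ContinuousAt (fun s => √(crit Q s)) 0 :=
      (hasDerivAt_crit hQ le_rfl).continuousAt.sqrt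
    have h2 := h1.tendsto.comp (hS0.mono_left (nhdsWithin_le_nhds (s := Set.Ioi 0)))
    simpa [Function.comp_def, crit_zero] using h2
  have hid : Tendsto (fun y : ℝ => y) (𝓝[>] 0) (𝓝 0) := tendsto_id.mono_left nhdsWithin_le_nhds
  -- Being strictly differentiable at `0`, `g` is Lipschitz near `0`.
  have hlip := (hg.hasStrictFDerivAt.isBigO_sub).comp_tendsto (hid.prodMk_nhds hst)
  have h := hlip.trans ((isBigO_neg_left.2 hsqrt).congr_left fun y => (neg_sub _ _))
  refine h.congr' ?_ EventuallyEq.rfl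
  filter_upwards [hSt.eventually hinv] with y hy
  rw [Function.comp_apply, hy]

/-- The polynomial `T = minimizerSeries Q` satisfies `T (1 + 2 Q S) = 2 S` up to order four, for
`S = excessSeries Q`. -/
theorem branch_sub_minimizerSeries_isBigO {Q : ℝ} {g : ℝ → ℝ} (hg : AnalyticAt ℝ g 0)
    (hg0 : g 0 = 0)
    (h : (fun y => g y - 2 * excessSeries Q y) =O[𝓝[>] 0] fun y => y ^ 5) :
    (fun y => g y / (1 + Q * g y) - minimizerSeries Q y) =O[𝓝[>] 0] fun y => y ^ 5 := by
  have hden : Tendsto (fun y => 1 + Q * g y) (𝓝[>] 0) (𝓝 1) := by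
    have h1 : Tendsto (fun y => 1 + Q * g y) (𝓝 0) (𝓝 (1 + Q * g 0)) :=
      (hg.continuousAt.const_mul Q).const_add 1
    rw [hg0, mul_zero, add_zero] at h1
    exact h1.mono_left nhdsWithin_le_nhds
  have hT : Continuous fun y => 1 - Q * minimizerSeries Q y := by
    unfold minimizerSeries; fun_prop
  have h1 : (fun y => (g y - 2 * excessSeries Q y) * (1 - Q * minimizerSeries Q y)) =O[𝓝[>] 0]
      fun y => y ^ 5 := by
    simpa using h.mul
      (((hT.tendsto 0).mono_left (nhdsWithin_le_nhds (s := Set.Ioi 0))).isBigO_one ℝ)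
  have h2 : (fun y => 2 * excessSeries Q y - minimizerSeries Q y * (1 + 2 * Q * excessSeries Q y))
      =O[𝓝[>] 0] fun y => y ^ 5 := by
    -- The values of the coefficients enter only through `h2`, `h3`, `h4`, the vanishing of the
    -- coefficients of `y ^ 2`, `y ^ 3`, `y ^ 4`.
    obtain ⟨b, hb⟩ : ∃ b, b = (2 * Q - 1) / 3 := ⟨_, rfl⟩
    obtain ⟨c, hc⟩ : ∃ c, c = (2 * Q ^ 2 - 2 * Q - 1) / 18 := ⟨_, rfl⟩
    obtain ⟨e, he⟩ : ∃ e, e = -(4 * Q ^ 3 - 6 * Q ^ 2 - 6 * Q + 4) / 135 := ⟨_, rfl⟩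
    obtain ⟨t, ht⟩ : ∃ t, t = -(8 * Q + 2) / 3 := ⟨_, rfl⟩
    obtain ⟨u, hu⟩ : ∃ u, u = (26 * Q ^ 2 + 22 * Q - 1) / 9 := ⟨_, rfl⟩
    obtain ⟨v, hv⟩ : ∃ v, v = -(368 * Q ^ 3 + 708 * Q ^ 2 - 12 * Q + 8) / 135 := ⟨_, rfl⟩
    refine ((isBigO_pow_mul_of_continuous (R := fun y => -(2 * Q) * ((2 * e + t * c + u * b + v) +
      (t * e + u * c + v * b) * y + (u * e + v * c) * y ^ 2 + v * e * y ^ 3)) (by fun_prop) 5).mono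
        nhdsWithin_le_nhds).congr_left fun y => ?_
    simp only [excessSeries, minimizerSeries, ← hb, ← hc, ← he, ← ht, ← hu, ← hv]
    have h2 : 2 * b - t - 4 * Q = 0 := by rw [hb, ht]; ring
    have h3 : 2 * c - u - 2 * Q * (2 * b + t) = 0 := by rw [hb, hc, ht, hu]; ring
    have h4 : 2 * e - v - 2 * Q * (2 * c + t * b + u) = 0 := by
      rw [hb, hc, he, ht, hu, hv]; ring
    linear_combination (-y ^ 2) * h2 - y ^ 3 * h3 - y ^ 4 * h4
  have h3 : (fun y => (1 + Q * g y)⁻¹) =O[𝓝[>] 0] fun _ => (1 : ℝ) :=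
    (hden.inv₀ one_ne_zero).isBigO_one ℝ
  have h4 := (h1.add h2).mul h3
  simp only [mul_one] at h4
  refine h4.congr' ?_ EventuallyEq.rfl
  filter_upwards [hden.eventually_ne one_ne_zero] with y hy
  rw [div_sub' hy, div_eq_mul_inv]
  congr 1
  ring

/-! ### Translation to the probability variable and the regime -/

theorem one_lt_bigQ {q : ℕ} (hq : 2 ≤ q) : 1 < bigQ q := by
  have : (2 : ℝ) ≤ q := by exact_mod_cast hq
  rw [bigQ, lt_div_iff₀ (by linarith)]
  linarith

/-- The substitution `p = s / (1 + Q s)` parametrizes the admissible probabilities by `s > 0`. -/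
theorem probs_eq_image {q : ℕ} (hq : 2 ≤ q) :
    probs q = (fun s => s / (1 + bigQ q * s)) '' Set.Ioi 0 := by
  have hQ := one_lt_bigQ hq
  have hQ0 : 0 < bigQ q := by linarith
  have hend : ((q : ℝ) - 1) / q = 1 / bigQ q := by rw [bigQ, one_div_div]
  ext p
  rw [probs, hend, Set.mem_Ioo, lt_div_iff₀ hQ0]
  constructor
  · rintro ⟨hp0, hp1⟩
    have hp2 : 0 < 1 - bigQ q * p := by linarith
    refine ⟨p / (1 - bigQ q * p), div_pos hp0 hp2, ?_⟩
    have : 1 + bigQ q * (p / (1 - bigQ q * p)) = 1 / (1 - bigQ q * p) := by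
      rw [eq_div_iff hp2.ne', add_mul, mul_assoc, div_mul_cancel₀ _ hp2.ne']; ring
    simp only [this]
    rw [div_div_div_cancel_right₀ hp2.ne', div_one]
  · rintro ⟨s, hs, rfl⟩
    have hs' : 0 < s := hs
    have hA : 0 < 1 + bigQ q * s := by positivity
    refine ⟨by positivity, ?_⟩
    rw [div_mul_eq_mul_div, div_lt_one hA]
    linarith

theorem kappa_pos {q k : ℕ} (hq : 2 ≤ q) (hk : 1 ≤ k) : 0 < kappa q k := by
  have h2 : (2 : ℝ) ≤ q := by exact_mod_cast hq
  have hk' : (1 : ℝ) ≤ k := by exact_mod_cast hk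
  have h1 : Real.log ((q : ℝ) - 1) < Real.log q := Real.log_lt_log (by linarith) (by linarith)
  have h3 : 0 < Real.log (q : ℝ) := Real.log_pos (by linarith)
  rw [kappa]
  nlinarith

theorem h_eq_ratio {q : ℕ} (hq : 2 ≤ q) (d k : ℕ) {s : ℝ} (hs : 0 < s) :
    h q d k (s / (1 + bigQ q * s)) = ratio (bigQ q) d (kappa q k) s := by
  have hQ := one_lt_bigQ hq
  have hQ' : 0 < bigQ q - 1 := by linarith
  have hA : 0 < 1 + bigQ q * s := by positivity
  have hB : 0 < 1 + (bigQ q - 1) * s := by positivity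
  have h1 : 1 - bigQ q * (s / (1 + bigQ q * s)) = (1 + bigQ q * s)⁻¹ := by field_simp; ring
  have h2 : 1 - s / (1 + bigQ q * s) = (1 + (bigQ q - 1) * s) / (1 + bigQ q * s) := by
    field_simp; ring
  rw [h, h1, h2, Real.log_inv, Real.log_div hB.ne' hA.ne', ratio, kappa, ← neg_div_neg_eq]
  congr 1 <;> ring

theorem isMinimizer_iff {q d k : ℕ} (hq : 2 ≤ q) (hd : 1 ≤ d) {s₀ : ℝ} (hs₀ : 0 < s₀)
    (hc : crit (bigQ q) s₀ = kappa q k / (2 * d * bigQ q * (bigQ q - 1))) {p : ℝ} :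
    IsMinimizer q d k p ↔ p = s₀ / (1 + bigQ q * s₀) := by
  have hQ := one_lt_bigQ hq
  have hd' : (0 : ℝ) < d := by exact_mod_cast hd
  have hmem : s₀ / (1 + bigQ q * s₀) ∈ probs q := by
    rw [probs_eq_image hq]; exact ⟨s₀, hs₀, rfl⟩
  constructor
  · rintro ⟨hp, hmin⟩
    have h1 : h q d k p ≤ h q d k (s₀ / (1 + bigQ q * s₀)) := hmin hmem
    rw [probs_eq_image hq] at hp
    obtain ⟨s, hs, rfl⟩ := hp
    by_contra hne
    have h2 := ratio_lt_ratio hQ hd' hs₀ hc hs (fun h => hne (by rw [h]))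
    rw [← h_eq_ratio hq d k hs₀, ← h_eq_ratio hq d k hs] at h2
    exact absurd h1 (not_le.2 h2)
  · rintro rfl
    refine ⟨hmem, fun p hp => ?_⟩
    rw [probs_eq_image hq] at hp
    obtain ⟨s, hs, rfl⟩ := hp
    change h q d k _ ≤ h q d k _
    rw [h_eq_ratio hq d k hs₀, h_eq_ratio hq d k hs]
    rcases eq_or_ne s s₀ with rfl | hne
    · exact le_rfl
    · exact (ratio_lt_ratio hQ hd' hs₀ hc hs hne).le

theorem exists_minimizer_parameter {q d k : ℕ} (hq : 2 ≤ q) (hd : 1 ≤ d) (hk : 1 ≤ k) :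
    ∃ s₀, 0 < s₀ ∧ crit (bigQ q) s₀ = kappa q k / (2 * d * bigQ q * (bigQ q - 1)) := by
  have hQ := one_lt_bigQ hq
  have hQ' : 0 < bigQ q - 1 := by linarith
  have hd' : (0 : ℝ) < d := by exact_mod_cast hd
  have := kappa_pos hq hk
  exact exists_crit_eq hQ (by positivity)

theorem pMin_eq {q d k : ℕ} (hq : 2 ≤ q) (hd : 1 ≤ d) {s₀ : ℝ} (hs₀ : 0 < s₀)
    (hc : crit (bigQ q) s₀ = kappa q k / (2 * d * bigQ q * (bigQ q - 1))) :
    pMin q d k = s₀ / (1 + bigQ q * s₀) :=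
  (isMinimizer_iff hq hd hs₀ hc).1
    (Classical.epsilon_spec ⟨_, (isMinimizer_iff hq hd hs₀ hc).2 rfl⟩)

theorem isLeast_of_isMinimizer {q d k : ℕ} {p : ℝ} (hp : IsMinimizer q d k p) :
    IsLeast (h q d k '' probs q) (h q d k p) :=
  ⟨Set.mem_image_of_mem _ hp.1, Set.forall_mem_image.2 fun _ hx => hp.2 hx⟩

theorem mu_eq {q d k : ℕ} (hq : 2 ≤ q) (hd : 1 ≤ d) {s₀ : ℝ} (hs₀ : 0 < s₀)
    (hc : crit (bigQ q) s₀ = kappa q k / (2 * d * bigQ q * (bigQ q - 1))) :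
    mu q d k = d * bigQ q * (1 + (bigQ q - 1) * s₀) := by
  rw [mu, (isLeast_of_isMinimizer ((isMinimizer_iff hq hd hs₀ hc).2 rfl)).csInf_eq,
    h_eq_ratio hq d k hs₀, ratio_of_crit_eq (one_lt_bigQ hq) (by exact_mod_cast hd) hs₀ hc]

theorem tendsto_yPar (q : ℕ) : Tendsto (fun x : ℕ × ℕ => yPar q x.1 x.2) regime (𝓝 0) := by
  have hd : Tendsto (fun x : ℕ × ℕ => (x.1 : ℝ)) regime atTop :=
    tendsto_natCast_atTop_atTop.comp
      (tendsto_comap.mono_left (inf_le_left.trans inf_le_left))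
  have hkd : Tendsto (fun x : ℕ × ℕ => (x.2 : ℝ) / (x.1 : ℝ)) regime (𝓝 0) :=
    tendsto_comap.mono_left (inf_le_left.trans inf_le_right)
  have h1 := ((hkd.mul_const (Real.log q)).sub
    (hd.const_div_atTop (Real.log ((q : ℝ) - 1)))).div_const (2 * bigQ q * (bigQ q - 1))
  have h2 := h1.sqrt
  simp only [zero_mul, sub_zero, zero_div, Real.sqrt_zero] at h2
  refine h2.congr fun x => ?_
  rw [yPar, kappa]
  congr 1
  rw [div_mul_eq_mul_div, ← sub_div, div_div]
  congr 1
  ring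

theorem eventually_one_le_regime : ∀ᶠ x in regime, 1 ≤ x.1 ∧ 1 ≤ x.2 := by
  have h1 : Tendsto (fun x : ℕ × ℕ => x.1) regime atTop :=
    tendsto_comap.mono_left (inf_le_left.trans inf_le_left)
  have h2 : ∀ᶠ x : ℕ × ℕ in regime, 1 ≤ x.2 :=
    (inf_le_right : regime ≤ 𝓟 {x : ℕ × ℕ | 1 ≤ x.2}) (mem_principal_self _)
  exact (h1.eventually_ge_atTop 1).and h2

/-- Since `crit` is increasing and `y → 0`, the root `s` of the critical equation is eventually so
small that it is `g y`. -/
theorem eventually_eq_branch {q : ℕ} (hq : 2 ≤ q) {g : ℝ → ℝ}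
    (hinv : ∀ᶠ s in 𝓝[>] 0, g √(crit (bigQ q) s) = s) :
    ∀ᶠ x in regime,
      pMin q x.1 x.2 = g (yPar q x.1 x.2) / (1 + bigQ q * g (yPar q x.1 x.2)) ∧
      mu q x.1 x.2 = x.1 * bigQ q +
        2 * x.1 * bigQ q * (bigQ q - 1) * (g (yPar q x.1 x.2) / 2) := by
  have hQ := one_lt_bigQ hq
  obtain ⟨δ, hδ, hδg⟩ := mem_nhdsGT_iff_exists_Ioo_subset.1 hinv
  have hδ0 : 0 < δ := hδ
  have hcδ : 0 < crit (bigQ q) δ := by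
    rw [← crit_zero (bigQ q)]
    exact strictMonoOn_crit hQ Set.self_mem_Ici hδ0.le hδ0
  have hy := (tendsto_yPar q).eventually_lt_const (Real.sqrt_pos.2 hcδ)
  filter_upwards [hy, eventually_one_le_regime] with x hx hx1
  obtain ⟨s, hs, hc⟩ := exists_minimizer_parameter hq hx1.1 hx1.2
  have hys : yPar q x.1 x.2 = √(crit (bigQ q) s) := by rw [yPar, hc]
  have hsδ : s < δ := by
    rw [hys] at hx
    exact ((strictMonoOn_crit hQ).lt_iff_lt hs.le hδ0.le).1 
      (lt_of_not_ge fun h => hx.not_ge (Real.sqrt_le_sqrt h))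
  have hgs : g (yPar q x.1 x.2) = s := by rw [hys]; exact hδg ⟨hs, hsδ⟩
  rw [hgs, pMin_eq hq hx1.1 hs hc, mu_eq hq hx1.1 hs hc]
  exact ⟨rfl, by ring⟩

/-- The coefficients of `excessSeries`, extended by zero. -/
def excessCoeff (Q : ℝ) : ℕ → ℝ
  | 1 => 1
  | 2 => (2 * Q - 1) / 3
  | 3 => (2 * Q ^ 2 - 2 * Q - 1) / 18
  | 4 => -(4 * Q ^ 3 - 6 * Q ^ 2 - 6 * Q + 4) / 135
  | _ => 0

/-- The coefficients of `minimizerSeries`, extended by zero. -/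
def minimizerCoeff (Q : ℝ) : ℕ → ℝ
  | 1 => 2
  | 2 => -(8 * Q + 2) / 3
  | 3 => (26 * Q ^ 2 + 22 * Q - 1) / 9
  | 4 => -(368 * Q ^ 3 + 708 * Q ^ 2 - 12 * Q + 8) / 135
  | _ => 0

theorem sum_excessCoeff (Q y : ℝ) :
    ∑ i ∈ Finset.Icc 1 4, excessCoeff Q i * y ^ i = excessSeries Q y := by
  simp [show Finset.Icc 1 4 = {1, 2, 3, 4} by rfl, excessCoeff, excessSeries]
  ring

theorem sum_minimizerCoeff (Q y : ℝ) :
    ∑ i ∈ Finset.Icc 1 4, minimizerCoeff Q i * y ^ i = minimizerSeries Q y := by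
  simp [show Finset.Icc 1 4 = {1, 2, 3, 4} by rfl, minimizerCoeff, minimizerSeries]
  ring

end ErrorDetection

end

open ErrorDetection

theorem mainTheorem3 (q : ℕ) (hq : 2 ≤ q) :
    (∀ d k : ℕ, 1 ≤ d → 1 ≤ k →
      ErrorDetection.IsMinimizer q d k (ErrorDetection.pMin q d k) ∧
      (∀ p : ℝ, ErrorDetection.IsMinimizer q d k p → p = ErrorDetection.pMin q d k) ∧
      IsLeast (ErrorDetection.h q d k '' ErrorDetection.probs q) (ErrorDetection.mu q d k)) ∧
    ∃ a b : ℕ → ℝ,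
      (∀ r : ℕ,
        ((fun x : ℕ × ℕ => ErrorDetection.pMin q x.1 x.2 -
            ∑ i ∈ Finset.Icc 1 r, a i * ErrorDetection.yPar q x.1 x.2 ^ i)
          =O[ErrorDetection.regime]
            fun x : ℕ × ℕ => ErrorDetection.yPar q x.1 x.2 ^ (r + 1)) ∧
        ((fun x : ℕ × ℕ => ErrorDetection.mu q x.1 x.2 -
            ((x.1 : ℝ) * ErrorDetection.bigQ q +
              2 * (x.1 : ℝ) * ErrorDetection.bigQ q * (ErrorDetection.bigQ q - 1) *
                ∑ i ∈ Finset.Icc 1 r, b i * ErrorDetection.yPar q x.1 x.2 ^ i))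
          =O[ErrorDetection.regime]
            fun x : ℕ × ℕ => (x.1 : ℝ) * ErrorDetection.yPar q x.1 x.2 ^ (r + 1))) ∧
      a 1 = 2 ∧
      a 2 = -(8 * ErrorDetection.bigQ q + 2) / 3 ∧
      a 3 = (26 * ErrorDetection.bigQ q ^ 2 + 22 * ErrorDetection.bigQ q - 1) / 9 ∧
      a 4 = -(368 * ErrorDetection.bigQ q ^ 3 + 708 * ErrorDetection.bigQ q ^ 2 -
        12 * ErrorDetection.bigQ q + 8) / 135 ∧
      b 1 = 1 ∧
      b 2 = (2 * ErrorDetection.bigQ q - 1) / 3 ∧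
      b 3 = (2 * ErrorDetection.bigQ q ^ 2 - 2 * ErrorDetection.bigQ q - 1) / 18 ∧
      b 4 = -(4 * ErrorDetection.bigQ q ^ 3 - 6 * ErrorDetection.bigQ q ^ 2 -
        6 * ErrorDetection.bigQ q + 4) / 135 := by

  have hQ := one_lt_bigQ hq
  refine ⟨fun d k hd hk => ?_, ?_⟩
  · obtain ⟨s, hs, hc⟩ := exists_minimizer_parameter hq hd hk
    have hp := pMin_eq hq hd hs hc
    have hmin := (isMinimizer_iff hq hd hs hc).2 hp
    refine ⟨hmin, fun p hp' => ?_, ?_⟩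
    · rw [hp, (isMinimizer_iff hq hd hs hc).1 hp']
    · have hleast := isLeast_of_isMinimizer hmin
      rwa [mu, hleast.csInf_eq]
  · obtain ⟨g, hg, hg0, hinv⟩ := exists_branch hQ
    have hgb := branch_sub_excessSeries_isBigO hQ hg hinv
    have hga := branch_sub_minimizerSeries_isBigO hg hg0 hgb
    have hanB : AnalyticAt ℝ (fun y => g y / 2) 0 := by fun_prop
    have hanA : AnalyticAt ℝ (fun y => g y / (1 + bigQ q * g y)) 0 :=
      AnalyticAt.div hg (by fun_prop) (by simp [hg0])
    obtain ⟨a, ha⟩ := exists_asymptotic_expansion hanA (by simp [hg0])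
    obtain ⟨b, hb⟩ := exists_asymptotic_expansion hanB (by simp [hg0])
    have ha4 : ∀ i ∈ Finset.Icc 1 4, a i = minimizerCoeff (bigQ q) i :=
      asymptotic_expansion_unique ((ha 4).mono nhdsWithin_le_nhds)
        (by simpa only [sum_minimizerCoeff] using hga)
    have hb4 : ∀ i ∈ Finset.Icc 1 4, b i = excessCoeff (bigQ q) i := by
      refine asymptotic_expansion_unique ((hb 4).mono nhdsWithin_le_nhds) ?_
      simp only [sum_excessCoeff]
      exact (hgb.const_mul_left (1 / 2)).congr_left fun y => by ring
    have hev := eventually_eq_branch hq hinv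
    refine ⟨a, b, fun r => ⟨?_, ?_⟩, ha4 1 (by simp), ha4 2 (by simp), ha4 3 (by simp),
      ha4 4 (by simp), hb4 1 (by simp), hb4 2 (by simp), hb4 3 (by simp), hb4 4 (by simp)⟩
    · refine ((ha r).comp_tendsto (tendsto_yPar q)).congr' ?_ EventuallyEq.rfl
      filter_upwards [hev] with x hx
      rw [hx.1]
      rfl
    · have h1 := (isBigO_refl (fun x : ℕ × ℕ => (x.1 : ℝ)) regime).mul
        (((hb r).comp_tendsto (tendsto_yPar q)).const_mul_left (2 * bigQ q * (bigQ q - 1)))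
      refine h1.congr' ?_ EventuallyEq.rfl
      filter_upwards [hev] with x hx
      rw [hx.2]
      simp only [Function.comp_apply]
      ring
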